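/- Let $G$ and $H$ be countable locally finite groups (every finitely generated subgroup is finite), each equipped with a proper left-invariant metric $d$, that is, a metric with $d(gx,gy)=d(x,y)$ for all $g,x,y$ and with $\{g : d(1,g)\le K\}$ finite for every $K>0$. Then $G$ and $H$ are coarsely equivalent if and only if they are both infinite or both finite. In particular, any two countably infinite locally finite groups, with any proper left-invariant metrics, are coarsely equivalent. Here a map $f:X\to Y$ of metric spaces is coarse if for every $\delta>0$ there is $\varepsilon>0$ such that $d_X(x,y)\le\delta$ implies $d_Y(f(x),f(y))\le\varepsilon$; $X$ and $Y$ are coarsely equivalent if there are coarse maps $f:X\to Y$, $g:Y\to X$ and constants $K_1,K_2>0$ with $d_X(g(f(x)),x)\le K_1$ for all $x\in X$ and $d_Y(f(g(y)),y)\le K_2$ for all $y\in Y$. -/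

import Mathlib

/-- A group is locally finite if each of its finitely generated subgroups is finite. -/
def IsLocallyFiniteGroup (G : Type*) [Group G] : Prop :=
  ∀ K : Subgroup G, K.FG → Finite K

/-- The metric of `G` is a proper left-invariant metric: left translations preserve distances, and
for every `K > 0` only finitely many elements `g` have norm `dist 1 g` at most `K`. -/
structure IsProperLeftInvariantMetric (G : Type*) [Group G] [MetricSpace G] : Prop where
  dist_mul_left : ∀ g h₁ h₂ : G, dist (g * h₁) (g * h₂) = dist h₁ h₂
  finite_norm_le : ∀ K : ℝ, 0 < K → {g : G | dist 1 g ≤ K}.Finite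

/-- Coarse maps between metric spaces. -/
def IsCoarseMap {X Y : Type*} [MetricSpace X] [MetricSpace Y] (f : X → Y) : Prop :=
  ∀ δ : ℝ, 0 < δ → ∃ ε : ℝ, 0 < ε ∧ ∀ x y : X, dist x y ≤ δ → dist (f x) (f y) ≤ ε

/-- A coarse equivalence is a coarse map that has a coarse inverse. -/
def IsCoarseEquivalence {X Y : Type*} [MetricSpace X] [MetricSpace Y] (f : X → Y) : Prop :=
  IsCoarseMap f ∧ ∃ g : Y → X, IsCoarseMap g ∧
    ∃ K₁ K₂ : ℝ, 0 < K₁ ∧ 0 < K₂ ∧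
      (∀ x : X, dist (g (f x)) x ≤ K₁) ∧ (∀ y : Y, dist (f (g y)) y ≤ K₂)

/-- Two metric spaces are coarsely equivalent if there is a coarse equivalence between them. -/
def CoarselyEquivalent (X Y : Type*) [MetricSpace X] [MetricSpace Y] : Prop :=
  ∃ f : X → Y, IsCoarseEquivalence f

/-! Finiteness is a coarse invariant here because balls are finite. For infinite groups, the metrics
matter only through exhaustions by finite subgroups: differences `x⁻¹ * y` are bounded iff they lie
in one member of the chain. `IsFiniteExhaustion.exists_enumeration` turns the cosets of the `k`th
subgroup into blocks of ℕ, so a coarse equivalence amounts to maps between block indices,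
alternating between `G` and `H`, whose two-step composites are the projections to coarser blocks.

These projections are divisions, but the orders in `G` need not divide those in `H`. Passing to
adjoints, one seeks increasing `p i` with `p i ∘ p (i + 1)` equal to multiplication by `m i`. Given
`p (i + 1)`, interpolation yields `p i`; a compactness argument handles the missing starting point
at infinity. Fast growth of the orders leaves room for the rounding. -/

/-! ### Adjoints and interpolation of integer sequences -/

/-- A strictly increasing sequence of naturals starting at `0` has an upper adjoint. -/
theorem StrictMono.exists_galoisConnection_nat {q : ℕ → ℕ} (hq : StrictMono q) (h0 : q 0 = 0) :
    ∃ φ : ℕ → ℕ, ∀ s n, q s ≤ n ↔ s ≤ φ n := by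
  refine ⟨fun n => Nat.findGreatest (fun s => q s ≤ n) n, fun s n => ⟨fun h => ?_, fun h => ?_⟩⟩
  · exact Nat.le_findGreatest ((hq.id_le s).trans h) h
  · have := Nat.findGreatest_spec (P := fun s => q s ≤ n) (Nat.zero_le n) (by simp [h0])
    exact (hq.monotone h).trans this

/-- `p` starts at `0` and its increments lie between `l` and `u`. -/
structure HasIncrementsIn (l u : ℕ) (p : ℕ → ℕ) : Prop where
  zero : p 0 = 0
  le_succ : ∀ t, p t + l ≤ p (t + 1)
  succ_le : ∀ t, p (t + 1) ≤ p t + u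

theorem HasIncrementsIn.strictMono {l u : ℕ} {p : ℕ → ℕ} (hp : HasIncrementsIn l u p)
    (hl : 1 ≤ l) : StrictMono p :=
  strictMono_nat_of_lt_succ fun t => by have := hp.le_succ t; omega

theorem HasIncrementsIn.le_mul {l u : ℕ} {p : ℕ → ℕ} (hp : HasIncrementsIn l u p) (t : ℕ) :
    p t ≤ u * t := by
  induction t with
  | zero => simp [hp.zero]
  | succ t ih => have := hp.succ_le t; rw [mul_add]; omega

theorem hasIncrementsIn_mul {l u : ℕ} (h : l ≤ u) : HasIncrementsIn l u (fun t => l * t) :=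
  ⟨by simp, fun t => by simp [mul_add], fun t => by simp [mul_add, h]⟩

/-- Interpolation: multiplication by `m` factors through every `q` with suitable increments. -/
theorem HasIncrementsIn.exists_comp_eq_mul {l u l' u' m : ℕ} {q : ℕ → ℕ}
    (hq : HasIncrementsIn l' u' q) (hl' : 1 ≤ l') (h₁ : l * u' ≤ m) (h₂ : m ≤ u * l') :
    ∃ p, HasIncrementsIn l u p ∧ ∀ s, p (q s) = m * s := by
  have hmono := hq.strictMono hl'
  obtain ⟨φ, hφ⟩ := hmono.exists_galoisConnection_nat hq.zero
  have hφq : ∀ s, φ (q s) = s := fun s =>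
    le_antisymm (hmono.le_iff_le.1 ((hφ _ _).2 le_rfl)) ((hφ _ _).1 le_rfl)
  -- Rounded-down linear interpolation between the points `(q s, m * s)`.
  let p : ℕ → ℕ := fun t => m * φ t + m * (t - q (φ t)) / (q (φ t + 1) - q (φ t))
  have hpq : ∀ s, p (q s) = m * s := fun s => by simp [p, hφq]
  -- The formula of the interval containing `t` still holds at its right endpoint, so each increment
  -- involves a single denominator `d`, and `l * d ≤ m ≤ u * d` bounds it.
  have hsucc : ∀ t, p (t + 1) =
      m * φ t + m * (t - q (φ t) + 1) / (q (φ t + 1) - q (φ t)) := by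
    intro t
    have hle : q (φ t) ≤ t := (hφ _ _).2 le_rfl
    have hlt : t < q (φ t + 1) := by
      by_contra! h
      have := (hφ _ _).1 h
      omega
    rcases Nat.lt_or_ge (t + 1) (q (φ t + 1)) with h | h
    · have : φ (t + 1) = φ t := by
        refine le_antisymm ?_ ((hφ _ _).1 (by omega))
        by_contra! h'
        have := (hφ (φ t + 1) (t + 1)).2 h'
        omega
      simp only [p, this]
      congr 3
      omega
    · have h' : t + 1 = q (φ t + 1) := by omega
      rw [h', hpq, show t - q (φ t) + 1 = q (φ t + 1) - q (φ t) by omega,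
        Nat.mul_div_cancel _ (by omega)]
      ring
  have hd : ∀ s, l' ≤ q (s + 1) - q s ∧ q (s + 1) - q s ≤ u' := fun s => by
    have := hq.le_succ s
    have := hq.succ_le s
    omega
  refine ⟨p, ⟨by simpa [hq.zero] using hpq 0, fun t => ?_, fun t => ?_⟩, hpq⟩
  · obtain ⟨hd₁, hd₂⟩ := hd (φ t)
    rw [hsucc]
    simp only [p, add_assoc]
    refine Nat.add_le_add_left ?_ _
    rw [← Nat.add_mul_div_right _ _ (hl'.trans hd₁)]
    refine Nat.div_le_div_right ?_
    rw [mul_add, mul_one]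
    exact Nat.add_le_add_left ((Nat.mul_le_mul_left _ hd₂).trans h₁) _
  · obtain ⟨hd₁, hd₂⟩ := hd (φ t)
    rw [hsucc]
    simp only [p, add_assoc]
    refine Nat.add_le_add_left ?_ _
    rw [← Nat.add_mul_div_right _ _ (hl'.trans hd₁)]
    refine Nat.div_le_div_right ?_
    rw [mul_add, mul_one]
    exact Nat.add_le_add_left (h₂.trans (Nat.mul_le_mul_left _ hd₁)) _

/-! ### Factoring divisions through interleaved maps -/

section Interleaving

variable {l u m : ℕ → ℕ}

/-- The construction runs backwards, from `p (j + 1)` to `p j`, starting with multiplication by a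
constant; hence the induction shifts `i`. -/
theorem exists_finite_interleaving (hl : ∀ i, 1 ≤ l i) (hlu : ∀ i, l i ≤ u i)
    (h₁ : ∀ i, l i * u (i + 1) ≤ m i) (h₂ : ∀ i, m i ≤ u i * l (i + 1)) (n i : ℕ) :
    ∃ p : ℕ → ℕ → ℕ, (∀ j ≤ n, HasIncrementsIn (l (i + j)) (u (i + j)) (p j)) ∧
      ∀ j < n, ∀ s, p j (p (j + 1) s) = m (i + j) * s := by
  induction n generalizing i with
  | zero =>
    refine ⟨fun j t => l (i + j) * t, fun j _ => hasIncrementsIn_mul (hlu _), fun j hj => ?_⟩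
    omega
  | succ n ih =>
    obtain ⟨p, hp, hpm⟩ := ih (i + 1)
    obtain ⟨q, hq, hqm⟩ := (hp 0 (Nat.zero_le _)).exists_comp_eq_mul (hl _) (h₁ i) (h₂ i)
    refine ⟨fun j => j.casesOn q p, fun j hj => ?_, fun j hj s => ?_⟩
    · cases j with
      | zero => exact hq
      | succ j => simpa [add_assoc, add_comm 1 j] using hp j (by omega)
    · cases j with
      | zero => exact hqm s
      | succ j => simpa [add_assoc, add_comm 1 j] using hpm j (by omega) s

/-- Infinite interleavings, obtained from the finite ones by a compactness argument. -/
theorem exists_interleaving (hl : ∀ i, 1 ≤ l i) (hlu : ∀ i, l i ≤ u i)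
    (h₁ : ∀ i, l i * u (i + 1) ≤ m i) (h₂ : ∀ i, m i ≤ u i * l (i + 1)) :
    ∃ p : ℕ → ℕ → ℕ, (∀ i, HasIncrementsIn (l i) (u i) (p i)) ∧
      ∀ i s, p i (p (i + 1) s) = m i * s := by
  choose P hP hPm using fun n => exists_finite_interleaving hl hlu h₁ h₂ n 0
  simp only [zero_add] at hP hPm
  -- The bound `u i * t` makes each value constant along the ultrafilter, and every condition
  -- involves finitely many values.
  let U : Ultrafilter ℕ := Filter.hyperfilter ℕ
  have hU : ∀ i, ∀ᶠ n in (U : Filter ℕ), i < n := fun i =>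
    Nat.hyperfilter_le_atTop (Filter.eventually_gt_atTop i)
  have hlim : ∀ i t, ∃ v, ∀ᶠ n in (U : Filter ℕ), P n i t = v := by
    intro i t
    have : ∀ᶠ n in (U : Filter ℕ), ∃ v ∈ Set.Iic (u i * t), P n i t = v := by
      filter_upwards [hU i] with n hn
      exact ⟨_, (hP n i hn.le).le_mul t, rfl⟩
    obtain ⟨v, -, hv⟩ := (Ultrafilter.eventually_exists_mem_iff (Set.finite_Iic _)).1 this
    exact ⟨v, hv⟩
  choose p hp using hlim
  refine ⟨p, fun i => ⟨?_, fun t => ?_, fun t => ?_⟩, fun i s => ?_⟩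
  · obtain ⟨n, hn, h⟩ := ((hU i).and (hp i 0)).exists
    rw [← h, (hP n i hn.le).zero]
  · obtain ⟨n, hn, h, h'⟩ := ((hU i).and ((hp i t).and (hp i (t + 1)))).exists
    rw [← h, ← h']
    exact (hP n i hn.le).le_succ t
  · obtain ⟨n, hn, h, h'⟩ := ((hU i).and ((hp i t).and (hp i (t + 1)))).exists
    rw [← h, ← h']
    exact (hP n i hn.le).succ_le t
  · obtain ⟨n, hn, h, h'⟩ :=
      ((hU i).and ((hp (i + 1) s).and (hp i (p (i + 1) s)))).exists
    rw [← h', ← h]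
    exact hPm n i hn s

/-- Adjoints compose in reverse order, and multiplication by `m i` has division by `m i` as its
upper adjoint. -/
theorem exists_seq_comp_eq_div (hl : ∀ i, 1 ≤ l i) (hlu : ∀ i, l i ≤ u i)
    (h₁ : ∀ i, l i * u (i + 1) ≤ m i) (h₂ : ∀ i, m i ≤ u i * l (i + 1)) :
    ∃ φ : ℕ → ℕ → ℕ, ∀ i n, φ (i + 1) (φ i n) = n / m i := by
  obtain ⟨p, hp, hpm⟩ := exists_interleaving hl hlu h₁ h₂
  choose φ hφ using fun i => ((hp i).strictMono (hl i)).exists_galoisConnection_nat (hp i).zero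
  refine ⟨φ, fun i n => eq_of_forall_le_iff fun s => ?_⟩
  have hm : 0 < m i := lt_of_lt_of_le
    (Nat.mul_pos (hl i) ((hl (i + 1)).trans (hlu (i + 1)))) (h₁ i)
  rw [← hφ, ← hφ, hpm, Nat.le_div_iff_mul_le hm, mul_comm]

end Interleaving

/-- A sequence of positive naturals that grows fast enough admits a system of maps
`φ i : ℕ → ℕ` which factor the divisions by the quotients `κ (i + 2) / κ i`. -/
theorem exists_seq_comp_eq_div_of_growth {κ : ℕ → ℕ} (h0 : ∀ i, 0 < κ i)
    (hgrow : ∀ i, κ i * (2 * κ i + 3) ≤ κ (i + 1)) :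
    ∃ φ : ℕ → ℕ → ℕ, ∀ i n, φ (i + 1) (φ i n) = n / (κ (i + 2) / κ i) := by
  let q : ℕ → ℕ := fun i => κ (i + 1) / κ i
  have hq : ∀ i, 2 * κ i + 3 ≤ q i := fun i => by
    rw [Nat.le_div_iff_mul_le (h0 i), mul_comm]
    exact hgrow i
  have hqκ : ∀ i, q i ≤ κ (i + 1) := fun i => Nat.div_le_self _ _
  have hlow : ∀ i, q i * κ i ≤ κ (i + 1) := fun i => Nat.div_mul_le_self _ _
  have hup : ∀ i, κ (i + 1) ≤ (q i + 1) * κ i := fun i =>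
    (Nat.lt_mul_div_succ (κ (i + 1)) (h0 i)).le.trans_eq (mul_comm _ _)
  -- The quotient `m i` lies between `q i * q (i + 1)` and `(q i + 1) * (q (i + 1) + 1)`; the
  -- margins `-1` and `+2` absorb this once `2 * q i + 3 ≤ q (i + 1)`.
  refine exists_seq_comp_eq_div (l := fun i => q i - 1) (u := fun i => q i + 2)
    (fun i => ?_) (fun i => ?_) (fun i => ?_) (fun i => ?_)
  · have := hq i
    show 1 ≤ q i - 1
    omega
  · show q i - 1 ≤ q i + 2
    omega
  · have h := hq i
    have h' := (Nat.mul_le_mul_left 2 (hqκ i)).trans ((Nat.le_add_right _ 3).trans (hq (i + 1)))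
    refine le_trans (b := q (i + 1) * q i) ?_ ?_
    · obtain ⟨c, hc⟩ : ∃ c, q i = c + 1 := ⟨q i - 1, by omega⟩
      simp only [hc, Nat.add_sub_cancel] at h' ⊢
      nlinarith
    · rw [Nat.le_div_iff_mul_le (h0 i), mul_assoc]
      exact (Nat.mul_le_mul_left _ (hlow i)).trans (hlow (i + 1))
  · have h := hq i
    have h' := (Nat.add_le_add_right (Nat.mul_le_mul_left 2 (hqκ i)) 3).trans (hq (i + 1))
    refine le_trans (b := (q (i + 1) + 1) * (q i + 1)) ?_ ?_
    · refine Nat.div_le_of_le_mul ?_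
      rw [mul_comm (κ i), mul_assoc]
      exact (hup (i + 1)).trans (Nat.mul_le_mul_left _ (hup i))
    · obtain ⟨c, hc⟩ : ∃ c, q (i + 1) = c + 1 := ⟨q (i + 1) - 1, by omega⟩
      simp only [hc, Nat.add_sub_cancel] at h' ⊢
      nlinarith

/-! ### Enumerations turning cosets into blocks -/

theorem exists_injective_nat_lt_card {Q : Type*} [Finite Q] (q₀ : Q) :
    ∃ f : Q → ℕ, Function.Injective f ∧ (∀ q, f q < Nat.card Q) ∧ f q₀ = 0 := by
  have : Nonempty Q := ⟨q₀⟩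
  let e := Finite.equivFin Q
  let z : Fin (Nat.card Q) := ⟨0, Nat.card_pos⟩
  refine ⟨fun q => Equiv.swap (e q₀) z (e q), ?_, fun q => Fin.is_lt _, ?_⟩
  · exact Fin.val_injective.comp ((Equiv.injective _).comp e.injective)
  · simp [z]

/-- For finite subgroups `K ≤ L`, a numbering `j` of the cosets of `K` in `L` together with a
choice `r` of coset representatives, both trivial on `K`. -/
theorem Subgroup.exists_coset_digits {G : Type*} [Group G] {K L : Subgroup G} [Finite L]
    (hKL : K ≤ L) :
    ∃ (j : G → ℕ) (r : G → G),
      (∀ x ∈ L, j x * Nat.card K + Nat.card K ≤ Nat.card L) ∧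
      (∀ x ∈ L, ∀ y ∈ L, j x = j y ↔ x⁻¹ * y ∈ K) ∧
      (∀ x, (r x)⁻¹ * x ∈ K) ∧ (∀ x y, x⁻¹ * y ∈ K → r x = r y) ∧
      ∀ x ∈ K, j x = 0 ∧ r x = 1 := by
  classical
  obtain ⟨f, hf, hlt, hf0⟩ :=
    exists_injective_nat_lt_card (Q := L ⧸ K.subgroupOf L) ((1 : L) : L ⧸ K.subgroupOf L)
  refine ⟨fun x => if h : x ∈ L then f ((⟨x, h⟩ : L) : L ⧸ K.subgroupOf L) else 0,
    fun x => if x ∈ K then 1 else (x : G ⧸ K).out, fun x hx => ?_, fun x hx y hy => ?_,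
    fun x => ?_, fun x y hxy => ?_, fun x hx => ⟨?_, if_pos hx⟩⟩
  · have hcard : Nat.card L = Nat.card (L ⧸ K.subgroupOf L) * Nat.card K := by
      rw [Subgroup.card_eq_card_quotient_mul_card_subgroup (K.subgroupOf L),
        Nat.card_congr (Subgroup.subgroupOfEquivOfLe hKL).toEquiv]
    simp only [hx, dif_pos]
    rw [hcard, ← Nat.succ_mul]
    exact Nat.mul_le_mul_right _ (hlt _)
  · simp only [hx, hy, dif_pos, hf.eq_iff, QuotientGroup.eq, Subgroup.mem_subgroupOf]
    rfl
  · by_cases hx : x ∈ K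
    · simp [hx]
    · simp only [hx, if_false]
      exact QuotientGroup.eq.1 (QuotientGroup.out_eq' (x : G ⧸ K))
  · have h : x ∈ K ↔ y ∈ K :=
      ⟨fun h => by simpa using K.mul_mem h hxy,
        fun h => by simpa using K.mul_mem h (K.inv_mem hxy)⟩
    simp only [h, QuotientGroup.eq.2 hxy]
  · simp only [hKL hx, dif_pos]
    rw [← hf0]
    congr 1
    rw [QuotientGroup.eq, Subgroup.mem_subgroupOf]
    simpa using hx

/-- An exhausting chain of finite subgroups starting with the trivial one. -/
structure IsFiniteExhaustion {G : Type*} [Group G] (A : ℕ → Subgroup G) : Prop where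
  zero : A 0 = ⊥
  mono : Monotone A
  finite : ∀ k, Finite (A k)
  exists_mem : ∀ x, ∃ k, x ∈ A k

/-- A countable group with an unbounded exhaustion by finite subgroups can be enumerated such that
the left cosets of these subgroups become blocks of consecutive naturals. -/
theorem IsFiniteExhaustion.exists_enumeration {G : Type*} [Group G] {A : ℕ → Subgroup G}
    (hA : IsFiniteExhaustion A) (hcard : ∀ n, ∃ k, n < Nat.card (A k)) :
    ∃ e : G → ℕ, Function.Surjective e ∧
      ∀ k x y, e x / Nat.card (A k) = e y / Nat.card (A k) ↔ x⁻¹ * y ∈ A k := by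
  have hfin := hA.finite
  have hpos : ∀ k, 0 < Nat.card (A k) := fun k => Nat.card_pos
  choose j r hj hjeq hr hreq h0 using
    fun k => Subgroup.exists_coset_digits (hA.mono (Nat.le_succ k))
  -- Mixed-radix expansion: the coset number is the leading digit. Since digits and representatives
  -- are trivial on `A k`, `E (k + 1)` extends `E k` from `A k`.
  let E : ℕ → G → ℕ := fun k => Nat.rec (fun _ => 0)
    (fun k e x => j k x * Nat.card (A k) + e ((r k x)⁻¹ * x)) k
  have hE : ∀ k x, E (k + 1) x = j k x * Nat.card (A k) + E k ((r k x)⁻¹ * x) :=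
    fun _ _ => rfl
  have hlt : ∀ k, ∀ x ∈ A k, E k x < Nat.card (A k) := by
    intro k
    induction k with
    | zero => exact fun x _ => hpos 0
    | succ k ih =>
      intro x hx
      rw [hE]
      exact (Nat.add_lt_add_left (ih _ (hr k x)) _).trans_le (hj k x hx)
  have hext : ∀ k k', k ≤ k' → ∀ x ∈ A k, E k' x = E k x := by
    intro k k' hk x hx
    induction k', hk using Nat.le_induction with
    | base => rfl
    | succ k' hk ih =>
      obtain ⟨h, h'⟩ := h0 k' x (hA.mono hk hx)
      rw [hE, h, h', zero_mul, zero_add, inv_one, one_mul, ih]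
  have hdiv : ∀ k l, l ≤ k → ∀ x ∈ A k, ∀ y ∈ A k,
      (E k x / Nat.card (A l) = E k y / Nat.card (A l) ↔ x⁻¹ * y ∈ A l) := by
    intro k
    induction k with
    | zero =>
      intro l hl x hx y hy
      obtain rfl : l = 0 := by omega
      exact iff_of_true rfl ((A 0).mul_mem ((A 0).inv_mem hx) hy)
    | succ k ih =>
      intro l hl x hx y hy
      rcases Nat.lt_or_ge k l with hkl | hkl
      · obtain rfl : l = k + 1 := by omega
        refine iff_of_true ?_ ((A _).mul_mem ((A _).inv_mem hx) hy)
        rw [Nat.div_eq_of_lt (hlt _ _ hx), Nat.div_eq_of_lt (hlt _ _ hy)]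
      · have hdvd := Subgroup.card_dvd_of_le (hA.mono hkl)
        have hblock : ∀ x, E (k + 1) x / Nat.card (A k) = j k x := fun x => by
          rw [hE, mul_comm, Nat.mul_add_div (hpos k), Nat.div_eq_of_lt (hlt k _ (hr k x)),
            add_zero]
        have hsplit : ∀ x, E (k + 1) x / Nat.card (A l) =
            j k x * (Nat.card (A k) / Nat.card (A l)) +
              E k ((r k x)⁻¹ * x) / Nat.card (A l) := fun x => by
          rw [hE, Nat.add_div_of_dvd_right (hdvd.mul_left _), Nat.mul_div_assoc _ hdvd]
        have hprod : ∀ x y, r k x = r k y →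
            ((r k x)⁻¹ * x)⁻¹ * ((r k y)⁻¹ * y) = x⁻¹ * y := fun x y h => by
          rw [h]; group
        constructor
        · intro h
          have hjxy : j k x = j k y := by
            rw [← hblock, ← hblock, ← Nat.mul_div_cancel' hdvd, ← Nat.div_div_eq_div_mul, h,
              Nat.div_div_eq_div_mul]
          have hrxy := hreq k x y ((hjeq k x hx y hy).1 hjxy)
          rw [hsplit, hsplit, hjxy, Nat.add_left_cancel_iff, ih l hkl _ (hr k x) _ (hr k y),
            hprod x y hrxy] at h
          exact h
        · intro h
          have hk := hA.mono hkl h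
          rw [hsplit, hsplit, (hjeq k x hx y hy).2 hk, Nat.add_left_cancel_iff,
            ih l hkl _ (hr k x) _ (hr k y), hprod x y (hreq k x y hk)]
          exact h
  choose N hN using hA.exists_mem
  have he : ∀ k, ∀ x ∈ A k, E (N x) x = E k x := fun k x hx => by
    rw [← hext _ _ (le_max_left (N x) k) x (hN x), ← hext _ _ (le_max_right (N x) k) x hx]
  refine ⟨fun x => E (N x) x, fun n => ?_, fun k x y => ?_⟩
  · obtain ⟨k, hk⟩ := hcard n
    let F : A k → Fin (Nat.card (A k)) := fun x => ⟨E k x, hlt k x x.2⟩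
    have hF : Function.Injective F := fun x y hxy => by
      have h := (hdiv k 0 (Nat.zero_le k) x x.2 y y.2).1 (by rw [Fin.mk.inj_iff.1 hxy])
      rw [hA.zero, Subgroup.mem_bot, inv_mul_eq_one] at h
      exact Subtype.ext h
    obtain ⟨x, hx⟩ :=
      (hF.bijective_of_nat_card_le (by simp)).surjective ⟨n, hk⟩
    exact ⟨x, (he k x x.2).trans (Fin.mk.inj_iff.1 hx)⟩
  · let M := max (max (N x) (N y)) k
    have hx : x ∈ A M := hA.mono ((le_max_left _ _).trans (le_max_left _ _)) (hN x)
    have hy : y ∈ A M := hA.mono ((le_max_right _ _).trans (le_max_left _ _)) (hN y)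
    simp only [he M x hx, he M y hy]
    exact hdiv M k (le_max_right _ _) x hx y hy

/-! ### Exhaustions with interleaved orders -/

theorem IsLocallyFiniteGroup.exists_finite_subgroup_ge {G : Type*} [Group G] [Infinite G]
    (hG : IsLocallyFiniteGroup G) (K : Subgroup G) [Finite K] (g : G) (n : ℕ) :
    ∃ L : Subgroup G, Finite L ∧ K ≤ L ∧ g ∈ L ∧ n ≤ Nat.card L := by
  obtain ⟨S, hS⟩ := Infinite.exists_subset_card_eq G n
  have hfin : ((K : Set G) ∪ ({g} ∪ (S : Set G))).Finite :=
    (Set.toFinite (K : Set G)).union ((Set.finite_singleton g).union S.finite_toSet)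
  let L := Subgroup.closure ((K : Set G) ∪ ({g} ∪ (S : Set G)))
  have hsub : (K : Set G) ∪ ({g} ∪ (S : Set G)) ⊆ L := Subgroup.subset_closure
  have hL : Finite L := hG L ((Subgroup.fg_iff _).2 ⟨_, rfl, hfin⟩)
  refine ⟨L, hL, fun x hx => hsub (Or.inl hx), hsub (Or.inr (Or.inl rfl)), ?_⟩
  rw [← hS, ← Set.ncard_coe_finset]
  exact Set.ncard_le_ncard (fun x hx => hsub (Or.inr (Or.inr hx))) (Set.toFinite (L : Set G))

/-- Two infinite countable locally finite groups have exhaustions by finite subgroups whose orders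
interleave with any prescribed growth. -/
theorem exists_interleaved_exhaustions {G H : Type*} [Group G] [Group H] [Countable G]
    [Countable H] [Infinite G] [Infinite H] (hG : IsLocallyFiniteGroup G)
    (hH : IsLocallyFiniteGroup H) (b : ℕ → ℕ) :
    ∃ (A : ℕ → Subgroup G) (B : ℕ → Subgroup H), IsFiniteExhaustion A ∧ IsFiniteExhaustion B ∧
      ∀ k, b (Nat.card (A k)) ≤ Nat.card (B (k + 1)) ∧
        b (Nat.card (B (k + 1))) ≤ Nat.card (A (k + 1)) := by
  obtain ⟨a, ha⟩ := exists_surjective_nat G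
  obtain ⟨c, hc⟩ := exists_surjective_nat H
  let S := {p : Subgroup G × Subgroup H // Finite p.1 ∧ Finite p.2}
  have hstep : ∀ (k : ℕ) (p : S), ∃ p' : S, (p.1.1 ≤ p'.1.1 ∧ p.1.2 ≤ p'.1.2) ∧
      (a k ∈ p'.1.1 ∧ c k ∈ p'.1.2) ∧ b (Nat.card p.1.1) ≤ Nat.card p'.1.2 ∧
        b (Nat.card p'.1.2) ≤ Nat.card p'.1.1 := by
    rintro k ⟨⟨K, L⟩, hK, hL⟩
    dsimp only at hK hL
    obtain ⟨L', hL', hLL', hcL', hbL'⟩ :=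
      hH.exists_finite_subgroup_ge L (c k) (b (Nat.card K))
    obtain ⟨K', hK', hKK', haK', hbK'⟩ :=
      hG.exists_finite_subgroup_ge K (a k) (b (Nat.card L'))
    exact ⟨⟨⟨K', L'⟩, hK', hL'⟩, ⟨hKK', hLL'⟩, ⟨haK', hcL'⟩, hbL', hbK'⟩
  choose F hle hmem hb using hstep
  let s : ℕ → S := fun k => Nat.rec ⟨(⊥, ⊥), inferInstance, inferInstance⟩ F k
  refine ⟨fun k => (s k).1.1, fun k => (s k).1.2,
    ⟨rfl, monotone_nat_of_le_succ fun k => (hle k (s k)).1, fun k => (s k).2.1, fun x => ?_⟩,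
    ⟨rfl, monotone_nat_of_le_succ fun k => (hle k (s k)).2, fun k => (s k).2.2, fun x => ?_⟩,
    fun k => hb k (s k)⟩
  · obtain ⟨k, rfl⟩ := ha x
    exact ⟨k + 1, (hmem k (s k)).1⟩
  · obtain ⟨k, rfl⟩ := hc x
    exact ⟨k + 1, (hmem k (s k)).2⟩

/-! ### Proper left-invariant metrics -/

namespace IsProperLeftInvariantMetric

variable {G : Type*} [Group G] [MetricSpace G]

theorem dist_eq (hd : IsProperLeftInvariantMetric G) (x y : G) :
    dist x y = dist 1 (x⁻¹ * y) := by
  rw [← hd.dist_mul_left x⁻¹ x y, inv_mul_cancel]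

theorem exists_mem_of_dist_le (hd : IsProperLeftInvariantMetric G) {A : ℕ → Subgroup G}
    (hA : IsFiniteExhaustion A) {δ : ℝ} (hδ : 0 < δ) :
    ∃ k, ∀ x y : G, dist x y ≤ δ → x⁻¹ * y ∈ A k := by
  choose N hN using hA.exists_mem
  obtain ⟨k, hk⟩ := ((hd.finite_norm_le δ hδ).image N).bddAbove
  refine ⟨k, fun x y h => hA.mono (hk ⟨_, ?_, rfl⟩) (hN _)⟩
  rwa [Set.mem_ofPred_eq, ← hd.dist_eq]

theorem exists_dist_le_of_mem (hd : IsProperLeftInvariantMetric G) (K : Subgroup G) [Finite K] :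
    ∃ ε : ℝ, 0 < ε ∧ ∀ x y : G, x⁻¹ * y ∈ K → dist x y ≤ ε := by
  obtain ⟨c, hc⟩ := ((Set.toFinite (K : Set G)).image fun g => dist 1 g).bddAbove
  refine ⟨max c 1, by positivity, fun x y h => ?_⟩
  rw [hd.dist_eq]
  exact (hc ⟨_, h, rfl⟩).trans (le_max_left _ _)

/-- Writing `x = h x * ((h x)⁻¹ * x)` puts `G` inside a product of the finite range and a finite
ball. -/
theorem finite_of_dist_le (hd : IsProperLeftInvariantMetric G) {h : G → G}
    (hfin : (Set.range h).Finite) {K : ℝ} (hK : 0 < K) (hdist : ∀ x, dist (h x) x ≤ K) :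
    Finite G := by
  refine Set.finite_univ_iff.1 ((hfin.mul (hd.finite_norm_le K hK)).subset fun x _ => ?_)
  refine ⟨h x, ⟨x, rfl⟩, (h x)⁻¹ * x, ?_, by simp⟩
  rw [Set.mem_ofPred_eq, ← hd.dist_eq]
  exact hdist x

end IsProperLeftInvariantMetric

/-! ### Coarse equivalences -/

theorem coarselyEquivalent_of_finite {X Y : Type*} [MetricSpace X] [MetricSpace Y] [Finite X]
    [Finite Y] [Nonempty X] [Nonempty Y] : CoarselyEquivalent X Y := by
  have hX : ∃ C : ℝ, 0 < C ∧ ∀ x y : X, dist x y ≤ C := by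
    obtain ⟨C, hC⟩ := (Set.finite_range fun p : X × X => dist p.1 p.2).bddAbove
    exact ⟨max C 1, by positivity, fun x y => (hC ⟨(x, y), rfl⟩).trans (le_max_left _ _)⟩
  have hY : ∃ C : ℝ, 0 < C ∧ ∀ x y : Y, dist x y ≤ C := by
    obtain ⟨C, hC⟩ := (Set.finite_range fun p : Y × Y => dist p.1 p.2).bddAbove
    exact ⟨max C 1, by positivity, fun x y => (hC ⟨(x, y), rfl⟩).trans (le_max_left _ _)⟩
  obtain ⟨C, hC0, hC⟩ := hX
  obtain ⟨D, hD0, hD⟩ := hY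
  exact ⟨fun _ => Classical.arbitrary Y, fun _ _ => ⟨D, hD0, fun _ _ _ => hD _ _⟩,
    fun _ => Classical.arbitrary X, fun _ _ => ⟨C, hC0, fun _ _ _ => hC _ _⟩, C, D, hC0, hD0,
    fun _ => hC _ _, fun _ => hD _ _⟩

theorem CoarselyEquivalent.finite_iff_finite {G H : Type*} [Group G] [MetricSpace G] [Group H]
    [MetricSpace H] (hdG : IsProperLeftInvariantMetric G) (hdH : IsProperLeftInvariantMetric H)
    (h : CoarselyEquivalent G H) : Finite G ↔ Finite H := by
  obtain ⟨f, -, g, -, K₁, K₂, hK₁, hK₂, h₁, h₂⟩ := h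
  constructor
  · intro _
    exact hdH.finite_of_dist_le (h := f ∘ g)
      ((Set.finite_range f).subset (Set.range_comp_subset_range g f)) hK₂ h₂
  · intro _
    exact hdG.finite_of_dist_le (h := g ∘ f)
      ((Set.finite_range g).subset (Set.range_comp_subset_range f g)) hK₁ h₁

theorem isCoarseMap_of_exhaustion {G H : Type*} [Group G] [MetricSpace G] [Group H]
    [MetricSpace H] (hdG : IsProperLeftInvariantMetric G) (hdH : IsProperLeftInvariantMetric H)
    {A : ℕ → Subgroup G} {B : ℕ → Subgroup H} (hA : IsFiniteExhaustion A)
    (hB : IsFiniteExhaustion B) {f : G → H}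
    (hf : ∀ k, ∃ l, ∀ x y, x⁻¹ * y ∈ A k → (f x)⁻¹ * f y ∈ B l) : IsCoarseMap f := by
  intro δ hδ
  obtain ⟨k, hk⟩ := hdG.exists_mem_of_dist_le hA hδ
  obtain ⟨l, hl⟩ := hf k
  have := hB.finite l
  obtain ⟨ε, hε, h⟩ := hdH.exists_dist_le_of_mem (B l)
  exact ⟨ε, hε, fun x y hxy => h _ _ (hl _ _ (hk _ _ hxy))⟩

theorem coarselyEquivalent_of_infinite {G H : Type*} [Group G] [Countable G] [Infinite G]
    [MetricSpace G] [Group H] [Countable H] [Infinite H] [MetricSpace H]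
    (hG : IsLocallyFiniteGroup G) (hH : IsLocallyFiniteGroup H)
    (hdG : IsProperLeftInvariantMetric G) (hdH : IsProperLeftInvariantMetric H) :
    CoarselyEquivalent G H := by
  obtain ⟨A, B, hA, hB, hgrow⟩ :=
    exists_interleaved_exhaustions hG hH (fun n => n * (2 * n + 3))
  have hfinA := hA.finite
  have hfinB := hB.finite
  let α : ℕ → ℕ := fun k => Nat.card (A k)
  -- The shift skips `B 0 = ⊥`, whose order 1 equals `α 0`.
  let β : ℕ → ℕ := fun k => Nat.card (B (k + 1))
  have hα : ∀ k, 0 < α k := fun k => Nat.card_pos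
  have hβ : ∀ k, 0 < β k := fun k => Nat.card_pos
  have hαβ : ∀ k, α k * (2 * α k + 3) ≤ β k := fun k => (hgrow k).1
  have hβα : ∀ k, β k * (2 * β k + 3) ≤ α (k + 1) := fun k => (hgrow k).2
  have hαdvd : ∀ k, α k ∣ α (k + 1) := fun k =>
    Subgroup.card_dvd_of_le (hA.mono (Nat.le_succ k))
  have hβdvd : ∀ k, β k ∣ β (k + 1) := fun k =>
    Subgroup.card_dvd_of_le (hB.mono (Nat.le_succ (k + 1)))
  have hαlt : ∀ k, α k < β k := fun k => by nlinarith [hα k, hαβ k]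
  have hβlt : ∀ k, β k < α (k + 1) := fun k => by nlinarith [hβ k, hβα k]
  have hαmono : StrictMono α := strictMono_nat_of_lt_succ fun k => (hαlt k).trans (hβlt k)
  obtain ⟨e, he, heA⟩ := hA.exists_enumeration fun n =>
    ⟨n + 1, (Nat.lt_succ_self n).trans_le (hαmono.id_le (n + 1))⟩
  obtain ⟨e', he', heB⟩ := hB.exists_enumeration fun n =>
    ⟨n + 1, ((Nat.le_of_lt_succ (Nat.lt_succ_self n)).trans (hαmono.id_le n)).trans_lt (hαlt n)⟩
  obtain ⟨φ, ψ, hφ, hψ⟩ : ∃ φ ψ : ℕ → ℕ → ℕ,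
      (∀ k n, ψ k (φ k n) = n / (α (k + 1) / α k)) ∧
      ∀ k n, φ (k + 1) (ψ k n) = n / (β (k + 1) / β k) := by
    let κ : ℕ → ℕ := fun i => if i % 2 = 0 then α (i / 2) else β (i / 2)
    have hκα : ∀ k, κ (2 * k) = α k := fun k => by simp [κ]
    have hκβ : ∀ k, κ (2 * k + 1) = β k := fun k => by
      simp [κ, show (2 * k + 1) / 2 = k by omega]
    obtain ⟨φ, hφ⟩ := exists_seq_comp_eq_div_of_growth (κ := κ)
      (fun i => by
        obtain ⟨k, rfl | rfl⟩ := Nat.even_or_odd' i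
        · rw [hκα]; exact hα k
        · rw [hκβ]; exact hβ k)
      (fun i => by
        obtain ⟨k, rfl | rfl⟩ := Nat.even_or_odd' i
        · rw [hκα, hκβ]; exact hαβ k
        · rw [hκβ, show 2 * k + 1 + 1 = 2 * (k + 1) by ring, hκα]; exact hβα k)
    refine ⟨fun k => φ (2 * k), fun k => φ (2 * k + 1), fun k n => ?_, fun k n => ?_⟩
    · have := hφ (2 * k) n
      rwa [show 2 * k + 2 = 2 * (k + 1) by ring, hκα, hκα] at this
    · have := hφ (2 * k + 1) n
      rwa [show 2 * k + 1 + 2 = 2 * (k + 1) + 1 by ring, hκβ, hκβ] at this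
  have hdivα : ∀ k n, n / α k / (α (k + 1) / α k) = n / α (k + 1) := fun k n => by
    rw [Nat.div_div_eq_div_mul, Nat.mul_div_cancel' (hαdvd k)]
  have hdivβ : ∀ k n, n / β k / (β (k + 1) / β k) = n / β (k + 1) := fun k n => by
    rw [Nat.div_div_eq_div_mul, Nat.mul_div_cancel' (hβdvd k)]
  -- Only the block matters; its first point is an arbitrary choice.
  choose f hf using fun x => he' (β 0 * φ 0 (e x / α 0))
  choose g hg using fun y => he (α 1 * ψ 0 (e' y / β 0))
  -- On blocks of level `k`, `f` acts as `φ k`: both `φ (k + 1) ∘ ψ k ∘ φ k` and its regrouping are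
  -- a division composed with some `φ`.
  have hfk : ∀ k x, e' (f x) / β k = φ k (e x / α k) := by
    intro k x
    induction k with
    | zero => rw [hf, Nat.mul_div_cancel_left _ (hβ 0)]
    | succ k ih => rw [← hdivβ, ih, ← hψ, hφ, hdivα]
  have hgk : ∀ k y, e (g y) / α (k + 1) = ψ k (e' y / β k) := by
    intro k y
    induction k with
    | zero => rw [hg, Nat.mul_div_cancel_left _ (hα 1)]
    | succ k ih => rw [← hdivα, ih, ← hφ, hψ, hdivβ]
  obtain ⟨K₁, hK₁, h₁⟩ := hdG.exists_dist_le_of_mem (A 1)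
  obtain ⟨K₂, hK₂, h₂⟩ := hdH.exists_dist_le_of_mem (B 2)
  refine ⟨f, isCoarseMap_of_exhaustion hdG hdH hA hB fun k => ⟨k + 1, fun x y h => ?_⟩, g,
    isCoarseMap_of_exhaustion hdH hdG hB hA fun k => ⟨k + 1, fun x y h => ?_⟩, K₁, K₂, hK₁, hK₂,
    fun x => h₁ _ _ ?_, fun y => h₂ _ _ ?_⟩
  · refine (heB (k + 1) _ _).1 ((hfk k x).trans (Eq.trans ?_ (hfk k y).symm))
    exact congrArg _ ((heA k x y).2 h)
  · refine (heA (k + 1) _ _).1 ((hgk k x).trans (Eq.trans ?_ (hgk k y).symm))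
    exact congrArg _ ((heB (k + 1) x y).2 (hB.mono (Nat.le_succ k) h))
  · refine (heA 1 _ _).1 ((hgk 0 _).trans ?_)
    rw [hfk, hφ, hdivα]
  · refine (heB 2 _ _).1 ((hfk 1 _).trans ?_)
    rw [hgk, hψ, hdivβ]

theorem mainTheorem9 {G : Type*} {H : Type*}
    [Group G] [Countable G] [MetricSpace G] [Group H] [Countable H] [MetricSpace H]
    (hG : IsLocallyFiniteGroup G) (hH : IsLocallyFiniteGroup H)
    (hdG : IsProperLeftInvariantMetric G) (hdH : IsProperLeftInvariantMetric H) :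
    CoarselyEquivalent G H ↔ (Infinite G ↔ Infinite H) := by
  constructor
  · intro h
    rw [← not_finite_iff_infinite, ← not_finite_iff_infinite,
      h.finite_iff_finite hdG hdH]
  · intro h
    rcases finite_or_infinite G with hfin | hinf
    · have : Finite H := not_infinite_iff_finite.1 fun hH' => not_finite_iff_infinite.2 (h.2 hH') hfin
      exact coarselyEquivalent_of_finite
    · have := h.1 hinf
      exact coarselyEquivalent_of_infinite hG hH hdG hdH
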